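/- Let $G$ be a locally compact Hausdorff topological group and $K$ a compact subgroup of $G$ such that $(G,K)$ is a Gelfand pair, i.e. the convolution algebra of $K$-biinvariant functions on $G$ that are integrable for left Haar measure is commutative. Let $\varphi:G\to\mathbb{C}$ be a continuous function which is $K$-biinvariant, i.e. $\varphi(k_1gk_2)=\varphi(g)$ for all $k_1,k_2\in K$ and $g\in G$, and of positive type, i.e. $\sum_{i=1}^n\sum_{j=1}^n c_i\overline{c_j}\,\varphi(g_j^{-1}g_i)\ge 0$ for all $n$, all $g_1,\dots,g_n\in G$ and all $c_1,\dots,c_n\in\mathbb{C}$. Let $(\pi^\varphi,\mathcal H^\varphi,\xi^\varphi)$ be its GNS triple: $\pi^\varphi$ is a (strongly continuous) unitary representation of $G$ on a complex Hilbert space $\mathcal H^\varphi$, and $\xi^\varphi\in\mathcal H^\varphi$ is a $K$-invariant cyclic vector with $\varphi(g)=\langle\pi^\varphi(g)\xi^\varphi,\xi^\varphi\rangle$ for all $g\in G$; such a triple exists and is unique up to unitary equivalence. Then the commutant $\pi^\varphi(G)'$, i.e. the algebra of all bounded operators on $\mathcal H^\varphi$ that commute with every $\pi^\varphi(g)$,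 $g\in G$, is commutative. -/

import Mathlib

open MeasureTheory
open scoped ComplexConjugate ComplexOrder

/-! ### Functions of positive type, biinvariance, Gelfand pairs -/

/-- A function `φ : G → ℂ` is of positive type if
`∑ i, ∑ j, c i * conj (c j) * φ ((g j)⁻¹ * g i)` is a nonnegative real number
for all finite families `g` in `G` and `c` in `ℂ`. -/
def IsPositiveType {G : Type*} [Group G] (φ : G → ℂ) : Prop :=
  ∀ (n : ℕ) (g : Fin n → G) (c : Fin n → ℂ),
    0 ≤ ∑ i, ∑ j, c i * conj (c j) * φ ((g j)⁻¹ * g i)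

/-- `f` is `K`-biinvariant: `f (k₁ * g * k₂) = f g` for `k₁, k₂ ∈ K` and `g ∈ G`. -/
def IsBiinvariant {G : Type*} [Group G] (K : Subgroup G) (f : G → ℂ) : Prop :=
  ∀ k₁ ∈ K, ∀ k₂ ∈ K, ∀ g : G, f (k₁ * g * k₂) = f g

/-- The convolution `(f ⋆ h) x = ∫ f y * h (y⁻¹ * x) dy` with respect to left Haar measure. -/
noncomputable def haarConvolution {G : Type*} [Group G] [TopologicalSpace G]
    [IsTopologicalGroup G] [LocallyCompactSpace G] [MeasurableSpace G] [BorelSpace G]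
    (f h : G → ℂ) : G → ℂ :=
  fun x => ∫ y, f y * h (y⁻¹ * x) ∂(Measure.haar : Measure G)

/-- `(G, K)` is a Gelfand pair: `K` is a compact subgroup of the locally compact group `G`, and
the convolution algebra of `K`-biinvariant integrable functions (modulo equality almost
everywhere) is commutative. -/
structure IsGelfandPair {G : Type*} [Group G] [TopologicalSpace G]
    [IsTopologicalGroup G] [LocallyCompactSpace G] [MeasurableSpace G] [BorelSpace G]
    (K : Subgroup G) : Prop where
  isCompact : IsCompact (K : Set G)
  convolution_comm : ∀ f h : G → ℂ,
    Integrable f (Measure.haar : Measure G) → Integrable h (Measure.haar : Measure G) →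
    IsBiinvariant K f → IsBiinvariant K h →
    haarConvolution f h =ᵐ[(Measure.haar : Measure G)] haarConvolution h f

/-! ### Unitary representations and GNS triples -/

/-- A unitary representation of a topological group `G` on a Hilbert space `H`: a homomorphism
into the unitary operators, continuous for the strong operator topology. -/
structure UnitaryRep (G H : Type*) [Group G] [TopologicalSpace G] [NormedAddCommGroup H]
    [InnerProductSpace ℂ H] [CompleteSpace H] where
  toMonoidHom : G →* (H →L[ℂ] H)
  mem_unitary : ∀ g, toMonoidHom g ∈ unitary (H →L[ℂ] H)
  continuous_apply : ∀ v : H, Continuous fun g => toMonoidHom g v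

/-- The commutant `π(G)'`: the algebra of bounded operators commuting with every `π(g)`. -/
def UnitaryRep.commutant {G H : Type*} [Group G] [TopologicalSpace G] [NormedAddCommGroup H]
    [InnerProductSpace ℂ H] [CompleteSpace H] (π : UnitaryRep G H) :
    Subalgebra ℂ (H →L[ℂ] H) :=
  Subalgebra.centralizer ℂ (Set.range π.toMonoidHom)

/-- `(π, H, ξ)` is a GNS triple of the function `φ`: the vector `ξ` is `K`-invariant and cyclic,
and `φ(g) = ⟨π(g)ξ, ξ⟩`. (Mathlib's inner product is linear in the second variable.) -/
structure IsGNSTriple {G H : Type*} [Group G] [TopologicalSpace G] [NormedAddCommGroup H]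
    [InnerProductSpace ℂ H] [CompleteSpace H] (K : Subgroup G) (φ : G → ℂ)
    (π : UnitaryRep G H) (ξ : H) : Prop where
  invariant : ∀ k ∈ K, π.toMonoidHom k ξ = ξ
  cyclic : (Submodule.span ℂ (Set.range fun g => π.toMonoidHom g ξ)).topologicalClosure = ⊤
  coeff : ∀ g, φ g = inner ℂ ξ (π.toMonoidHom g ξ)

/-! ### The GNS construction

`GNSPre hφ` is the space of finitely supported measures `μ = ∑ a_x δ_x` on `G` with the
semi-definite form `⟨ν, μ⟩ = ∑ conj (b_y) a_x φ (y⁻¹ x)`, on which `G` acts by left translation;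
the Hilbert space `GNSSpace hφ` is its separated completion. -/

namespace IsPositiveType

variable {G : Type*} [Group G] {φ : G → ℂ}

theorem conj_apply_inv (hφ : IsPositiveType φ) (g : G) : conj (φ g⁻¹) = φ g := by
  have h0 := (Complex.nonneg_iff.1 (hφ 1 ![1] ![1])).2
  have h1 := (Complex.nonneg_iff.1 (hφ 2 ![g, 1] ![1, 1])).2
  have h2 := (Complex.nonneg_iff.1 (hφ 2 ![g, 1] ![Complex.I, 1])).2
  simp [Fin.sum_univ_two] at h0 h1 h2
  apply Complex.ext
  · simp; linarith
  · simp; linarith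

end IsPositiveType

/-- The form `∑ conj (b_y) a_x φ (y⁻¹ x)` on finitely supported measures `ν = ∑ b_y δ_y` and
`μ = ∑ a_x δ_x` on `G`. -/
noncomputable def gnsForm {G : Type*} [Group G] (φ : G → ℂ) (ν μ : G →₀ ℂ) : ℂ :=
  ν.sum fun y b => μ.sum fun x a => conj b * a * φ (y⁻¹ * x)

namespace gnsForm

variable {G : Type*} [Group G] {φ : G → ℂ}

theorem conj_symm (hφ : IsPositiveType φ) (ν μ : G →₀ ℂ) :
    conj (gnsForm φ μ ν) = gnsForm φ ν μ := by
  unfold gnsForm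
  rw [Finsupp.sum_comm]
  simp only [map_finsuppSum]
  refine Finsupp.sum_congr fun y _ => Finsupp.sum_congr fun x _ => ?_
  rw [← hφ.conj_apply_inv (y⁻¹ * x)]
  simp [mul_comm]

theorem re_nonneg (hφ : IsPositiveType φ) (μ : G →₀ ℂ) : 0 ≤ (gnsForm φ μ μ).re := by
  have h := hφ μ.support.card (fun i => (μ.support.equivFin.symm i : G))
    (fun i => μ (μ.support.equivFin.symm i : G))
  refine (Complex.nonneg_iff.1 (h.trans_eq ?_)).1
  rw [Finset.sum_comm]
  unfold gnsForm Finsupp.sum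
  rw [← Finset.sum_coe_sort μ.support, ← μ.support.equivFin.symm.sum_comp]
  refine Finset.sum_congr rfl fun i _ => ?_
  dsimp only
  rw [← Finset.sum_coe_sort μ.support, ← μ.support.equivFin.symm.sum_comp]
  refine Finset.sum_congr rfl fun j _ => ?_
  ring

theorem add_left (ν ν' μ : G →₀ ℂ) :
    gnsForm φ (ν + ν') μ = gnsForm φ ν μ + gnsForm φ ν' μ := by
  unfold gnsForm
  refine Finsupp.sum_add_index' (by simp) fun y b b' => ?_
  rw [← Finsupp.sum_add]
  refine Finsupp.sum_congr fun x _ => ?_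
  rw [map_add]; ring

theorem smul_left (ν μ : G →₀ ℂ) (r : ℂ) :
    gnsForm φ (r • ν) μ = conj r * gnsForm φ ν μ := by
  unfold gnsForm
  rw [Finsupp.sum_smul_index (by simp)]
  simp only [Finsupp.mul_sum]
  refine Finsupp.sum_congr fun y _ => Finsupp.sum_congr fun x _ => ?_
  rw [map_mul]; ring

theorem single_single (y x : G) (b a : ℂ) :
    gnsForm φ (Finsupp.single y b) (Finsupp.single x a) = conj b * a * φ (y⁻¹ * x) := by
  unfold gnsForm
  rw [Finsupp.sum_single_index, Finsupp.sum_single_index] <;> simp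

theorem translate (g : G) (ν μ : G →₀ ℂ) :
    gnsForm φ (ν.mapDomain (g * ·)) (μ.mapDomain (g * ·)) = gnsForm φ ν μ := by
  unfold gnsForm
  rw [Finsupp.sum_mapDomain_index (by simp)]
  · refine Finsupp.sum_congr fun y _ => ?_
    rw [Finsupp.sum_mapDomain_index (by simp) (by intros; ring)]
    refine Finsupp.sum_congr fun x _ => ?_
    simp [mul_assoc]
  · intro y b b'
    rw [← Finsupp.sum_add]
    refine Finsupp.sum_congr fun x _ => ?_
    rw [map_add]; ring

end gnsForm

/-- Finitely supported complex measures on `G`, equipped below with the form `gnsForm φ`. -/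
def GNSPre {G : Type*} [Group G] {φ : G → ℂ} (_ : IsPositiveType φ) : Type _ := G →₀ ℂ

namespace GNSPre

variable {G : Type*} [Group G] {φ : G → ℂ} (hφ : IsPositiveType φ)

noncomputable instance : AddCommGroup (GNSPre hφ) := inferInstanceAs (AddCommGroup (G →₀ ℂ))

noncomputable instance : Module ℂ (GNSPre hφ) := inferInstanceAs (Module ℂ (G →₀ ℂ))

/-- The point mass `a δ_x`. -/
noncomputable def single (x : G) (a : ℂ) : GNSPre hφ := Finsupp.single x a

noncomputable instance : PreInnerProductSpace.Core ℂ (GNSPre hφ) where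
  inner := gnsForm φ
  conj_inner_symm := gnsForm.conj_symm hφ
  re_inner_nonneg := gnsForm.re_nonneg hφ
  add_left := gnsForm.add_left
  smul_left := gnsForm.smul_left

noncomputable instance : SeminormedAddCommGroup (GNSPre hφ) :=
  InnerProductSpace.Core.toSeminormedAddCommGroup (𝕜 := ℂ)

noncomputable instance : InnerProductSpace ℂ (GNSPre hφ) := .ofCore _

theorem inner_single (y x : G) (b a : ℂ) :
    inner ℂ (single hφ y b) (single hφ x a) = conj b * a * φ (y⁻¹ * x) :=
  gnsForm.single_single y x b a

/-- Left translation by `g` on finitely supported measures, `δ_x ↦ δ_{g x}`. -/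
noncomputable def translate (g : G) : GNSPre hφ →ₗ[ℂ] GNSPre hφ :=
  Finsupp.lmapDomain ℂ ℂ (g * ·)

theorem translate_single (g x : G) (a : ℂ) :
    translate hφ g (single hφ x a) = single hφ (g * x) a :=
  Finsupp.mapDomain_single

theorem inner_translate (g : G) (ν μ : GNSPre hφ) :
    inner ℂ (translate hφ g ν) (translate hφ g μ) = inner ℂ ν μ :=
  gnsForm.translate g ν μ

theorem norm_translate (g : G) (μ : GNSPre hφ) : ‖translate hφ g μ‖ = ‖μ‖ := by
  rw [@norm_eq_sqrt_re_inner ℂ, @norm_eq_sqrt_re_inner ℂ, inner_translate]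

theorem translate_one (μ : GNSPre hφ) : translate hφ 1 μ = μ := by
  have : ((1 : G) * ·) = id := by funext x; simp
  simp only [translate, this]
  exact Finsupp.mapDomain_id

theorem translate_mul (g h : G) (μ : GNSPre hφ) :
    translate hφ (g * h) μ = translate hφ g (translate hφ h μ) := by
  have : (g * h * ·) = (g * ·) ∘ (h * ·) := by funext x; simp [mul_assoc]
  simp only [translate, this]
  exact Finsupp.mapDomain_comp

theorem induction {p : GNSPre hφ → Prop} (μ : GNSPre hφ) (h0 : p 0)
    (ha : ∀ μ ν, p μ → p ν → p (μ + ν)) (hs : ∀ x a, p (single hφ x a)) : p μ :=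
  Finsupp.induction_linear μ h0 ha hs

/-- Left translation as a continuous linear map. -/
noncomputable def translateL (g : G) : GNSPre hφ →L[ℂ] GNSPre hφ :=
  (translate hφ g).mkContinuous 1 fun μ => by rw [norm_translate, one_mul]

theorem translateL_apply (g : G) (μ : GNSPre hφ) : translateL hφ g μ = translate hφ g μ := rfl

end GNSPre

/-- The GNS Hilbert space of a function of positive type. -/
abbrev GNSSpace {G : Type*} [Group G] {φ : G → ℂ} (hφ : IsPositiveType φ) : Type _ :=
  UniformSpace.Completion (GNSPre hφ)

/-- The GNS cyclic vector: the class of the point mass at the identity. -/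
noncomputable def gnsVector {G : Type*} [Group G] {φ : G → ℂ} (hφ : IsPositiveType φ) :
    GNSSpace hφ :=
  (GNSPre.single hφ 1 1 : GNSPre hφ)

namespace GNSSpace

variable {G : Type*} [Group G] {φ : G → ℂ} (hφ : IsPositiveType φ)

/-- The action of `G` on the GNS space, extending left translation of measures. -/
noncomputable def action : G →* (GNSSpace hφ →L[ℂ] GNSSpace hφ) where
  toFun g := (GNSPre.translateL hφ g).completion
  map_one' := by
    ext v
    induction v using UniformSpace.Completion.induction_on with
    | hp => exact isClosed_eq (by fun_prop) (by fun_prop)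
    | ih μ => simp [GNSPre.translateL_apply, GNSPre.translate_one]
  map_mul' g h := by
    ext v
    induction v using UniformSpace.Completion.induction_on with
    | hp => exact isClosed_eq (by fun_prop) (by fun_prop)
    | ih μ => simp [GNSPre.translateL_apply, GNSPre.translate_mul]

theorem action_coe (g : G) (μ : GNSPre hφ) :
    action hφ g (μ : GNSSpace hφ) = (GNSPre.translate hφ g μ : GNSPre hφ) := by
  simp [action, GNSPre.translateL_apply]

theorem norm_action (g : G) (v : GNSSpace hφ) : ‖action hφ g v‖ = ‖v‖ := by
  induction v using UniformSpace.Completion.induction_on with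
  | hp => exact isClosed_eq (by fun_prop) (by fun_prop)
  | ih μ => rw [action_coe, UniformSpace.Completion.norm_coe, UniformSpace.Completion.norm_coe,
      GNSPre.norm_translate]

theorem action_mem_unitary (g : G) : action hφ g ∈ unitary (GNSSpace hφ →L[ℂ] GNSSpace hφ) :=
  IsUnit.mem_unitary_of_star_mul_self ((Group.isUnit g).map (action hφ))
    ((action hφ g).norm_map_iff_adjoint_comp_self.mp (norm_action hφ g))

theorem continuous_action [TopologicalSpace G] [IsTopologicalGroup G] (hc : Continuous φ)
    (v : GNSSpace hφ) : Continuous fun g => action hφ g v := by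
  have hpre : ∀ μ : GNSPre hφ, Continuous fun g => action hφ g (μ : GNSSpace hφ) := by
    intro μ
    induction μ using GNSPre.induction with
    | h0 => simp only [UniformSpace.Completion.coe_zero, map_zero, continuous_const]
    | ha μ ν hμ hν =>
      simp only [UniformSpace.Completion.coe_add, map_add]
      exact hμ.add hν
    | hs x a =>
      rw [continuous_iff_continuousAt]
      intro g₀
      rw [ContinuousAt, tendsto_iff_norm_sub_tendsto_zero]
      have key : ∀ g, ‖action hφ g (GNSPre.single hφ x a : GNSPre hφ) -
          action hφ g₀ (GNSPre.single hφ x a : GNSPre hφ)‖ =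
          Real.sqrt (conj a * a * (2 * φ 1 - φ ((g * x)⁻¹ * (g₀ * x))
            - φ ((g₀ * x)⁻¹ * (g * x)))).re := by
        intro g
        rw [action_coe, action_coe, GNSPre.translate_single, GNSPre.translate_single,
          ← UniformSpace.Completion.coe_sub, UniformSpace.Completion.norm_coe,
          @norm_eq_sqrt_re_inner ℂ, inner_sub_left, inner_sub_right, inner_sub_right,
          GNSPre.inner_single, GNSPre.inner_single, GNSPre.inner_single, GNSPre.inner_single]
        simp only [inv_mul_cancel]
        congr 1
        rw [RCLike.re_eq_complex_re]
        congr 1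
        ring
      simp only [key]
      have hcont : Continuous fun g : G => Real.sqrt (conj a * a *
          (2 * φ 1 - φ ((g * x)⁻¹ * (g₀ * x)) - φ ((g₀ * x)⁻¹ * (g * x)))).re := by fun_prop
      have := hcont.tendsto g₀
      simp only [inv_mul_cancel] at this
      convert this using 2
      ring_nf
      simp
  rw [continuous_iff_continuousAt]
  intro g₀
  rw [Metric.continuousAt_iff']
  intro ε hε
  obtain ⟨w, ⟨μ, rfl⟩, hw⟩ := Metric.mem_closure_iff.1
    (UniformSpace.Completion.denseRange_coe (α := GNSPre hφ) v) (ε / 3) (by positivity)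
  filter_upwards [Metric.continuousAt_iff'.1 (hpre μ).continuousAt (ε / 3) (by positivity)]
    with g hg
  have hd : ∀ g, dist (action hφ g v) (action hφ g (μ : GNSSpace hφ)) = dist v μ := by
    intro g
    rw [dist_eq_norm, ← map_sub, norm_action, dist_eq_norm]
  calc dist (action hφ g v) (action hφ g₀ v)
      ≤ dist (action hφ g v) (action hφ g (μ : GNSSpace hφ))
        + dist (action hφ g (μ : GNSSpace hφ)) (action hφ g₀ (μ : GNSSpace hφ))
        + dist (action hφ g₀ (μ : GNSSpace hφ)) (action hφ g₀ v) := dist_triangle4 _ _ _ _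
    _ < ε := by rw [hd, dist_comm _ (action hφ g₀ v), hd]; linarith

end GNSSpace

/-- The GNS representation `π^φ` of a continuous function `φ` of positive type. -/
noncomputable def gnsRep {G : Type*} [Group G] [TopologicalSpace G] [IsTopologicalGroup G]
    {φ : G → ℂ} (hφ : IsPositiveType φ) (hc : Continuous φ) : UnitaryRep G (GNSSpace hφ) where
  toMonoidHom := GNSSpace.action hφ
  mem_unitary := GNSSpace.action_mem_unitary hφ
  continuous_apply := GNSSpace.continuous_action hφ hc

/-- The GNS construction yields a GNS triple. -/
theorem isGNSTriple_gnsRep {G : Type*} [Group G] [TopologicalSpace G] [IsTopologicalGroup G]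
    {K : Subgroup G} {φ : G → ℂ} (hφ : IsPositiveType φ) (hc : Continuous φ)
    (hK : IsBiinvariant K φ) : IsGNSTriple K φ (gnsRep hφ hc) (gnsVector hφ) where
  invariant k hk := by
    have h1 := hK 1 K.one_mem k hk 1
    have h2 := hK k⁻¹ (K.inv_mem hk) 1 K.one_mem 1
    simp only [mul_one, one_mul] at h1 h2
    change GNSSpace.action hφ k (GNSPre.single hφ 1 1 : GNSPre hφ) =
      (GNSPre.single hφ 1 1 : GNSPre hφ)
    rw [← sub_eq_zero, ← norm_eq_zero, GNSSpace.action_coe, GNSPre.translate_single,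
      ← UniformSpace.Completion.coe_sub, UniformSpace.Completion.norm_coe,
      @norm_eq_sqrt_re_inner ℂ, inner_sub_left, inner_sub_right, inner_sub_right,
      GNSPre.inner_single, GNSPre.inner_single, GNSPre.inner_single, GNSPre.inner_single]
    simp [h1, h2]
  cyclic := by
    rw [← Submodule.dense_iff_topologicalClosure_eq_top]
    refine (UniformSpace.Completion.denseRange_coe (α := GNSPre hφ)).mono ?_
    rintro _ ⟨μ, rfl⟩
    induction μ using GNSPre.induction with
    | h0 =>
      rw [UniformSpace.Completion.coe_zero]
      exact Submodule.zero_mem _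
    | ha μ ν hμ hν =>
      rw [UniformSpace.Completion.coe_add]
      exact Submodule.add_mem _ hμ hν
    | hs x a =>
      have : (GNSPre.single hφ x a : GNSPre hφ) = a • GNSPre.single hφ x 1 := by
        simp only [GNSPre.single]
        exact (Finsupp.smul_single_one x a).symm
      rw [this, UniformSpace.Completion.coe_smul]
      refine Submodule.smul_mem _ _ (Submodule.subset_span ⟨x, ?_⟩)
      change GNSSpace.action hφ x (GNSPre.single hφ 1 1 : GNSPre hφ) = _
      rw [GNSSpace.action_coe, GNSPre.translate_single, mul_one]
  coeff g := by
    change _ = inner ℂ (GNSPre.single hφ 1 1 : GNSSpace hφ)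
      (GNSSpace.action hφ g (GNSPre.single hφ 1 1 : GNSPre hφ))
    rw [GNSSpace.action_coe, GNSPre.translate_single, UniformSpace.Completion.inner_coe,
      GNSPre.inner_single]
    simp

/-!
Let `P` be the projection of `H` onto the `K`-invariant vectors of a unitary representation `π`
with a cyclic `K`-invariant vector `ξ`. The proof has three ingredients.

* The compressions `P π(g) P` commute with each other (`UnitaryRep.compression_comm`). For
  continuous compactly supported biinvariant `f` and `h`, the Gelfand property gives
  `π(f) π(h) = π(h) π(f)`, since integration turns convolution into composition
  (`UnitaryRep.integrated_apply_integrated`). The functions `f` and `h` can be replaced by group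
  elements because a continuous biinvariant function whose integrals against all such test functions
  vanish is zero (`eq_zero_of_forall_integral_biinvariant_smul_eq_zero`). Passing from `π(f)` to the
  compressions makes the set of operators visibly self-adjoint, as `(P π(g) P)* = P π(g⁻¹) P`, so
  that the modular function of `G` never enters.
* The compressions act on the invariant vectors with cyclic vector `ξ`, and every `S` in the
  commutant of `π` commutes with `P`, hence with the compressions, and maps `ξ` to an invariant
  vector.
* The commutant of a commutative self-adjoint space of operators with a cyclic vector is
  commutative, in the form `inner_apply_comm_of_commutative`. Therefore `S T ξ = T S ξ` for `S` and
  `T` in the commutant of `π`, and `S T = T S` because `ξ` is separating for that commutant.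
-/

/-! ### Biinvariant test functions -/

/-- Around every point there is a biinvariant bump function. It is the supremum of an ordinary bump
function over the translates by `K × K`, which avoids choosing a Haar measure on `K`. -/
theorem exists_biinvariant_bump {G : Type*} [Group G] [TopologicalSpace G]
    [IsTopologicalGroup G] [T2Space G] [LocallyCompactSpace G] {K : Subgroup G}
    (hK : IsCompact (K : Set G)) (g : G) :
    ∃ χ : G → ℝ, Continuous χ ∧ HasCompactSupport χ ∧ 0 ≤ χ ∧ χ g ≠ 0 ∧
      ∀ k₁ ∈ K, ∀ k₂ ∈ K, ∀ x, χ (k₁ * x * k₂) = χ x := by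
  obtain ⟨F, hFc, hF0, hFg⟩ := exists_continuous_nonneg_pos g
  have hKK : IsCompact ((K : Set G) ×ˢ (K : Set G)) := hK.prod hK
  let Φ : G → G × G → ℝ := fun x p => F (p.1 * x * p.2)
  have hΦ : Continuous ↿Φ :=
    F.continuous.comp (by fun_prop : Continuous fun q : G × G × G => q.2.1 * q.1 * q.2.2)
  refine ⟨fun x => sSup (Φ x '' ((K : Set G) ×ˢ (K : Set G))), hKK.continuous_sSup hΦ,
    ?_, ?_, ?_, ?_⟩
  · refine HasCompactSupport.intro ((hK.mul hFc).mul hK) fun x hx => ?_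
    have h0 : ∀ p ∈ (K : Set G) ×ˢ (K : Set G), Φ x p = 0 := by
      rintro ⟨a, b⟩ ⟨ha, hb⟩
      by_contra hne
      refine hx ⟨a⁻¹ * (a * x * b), ⟨a⁻¹, K.inv_mem ha, a * x * b, subset_tsupport _ hne, rfl⟩,
        b⁻¹, K.inv_mem hb, ?_⟩
      group
    have : Φ x '' ((K : Set G) ×ˢ (K : Set G)) = {0} := by
      ext t
      constructor
      · rintro ⟨p, hp, rfl⟩
        exact h0 p hp
      · rintro rfl
        exact ⟨(1, 1), ⟨K.one_mem, K.one_mem⟩, h0 _ ⟨K.one_mem, K.one_mem⟩⟩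
    simp only [this, csSup_singleton]
  · intro x
    refine Real.sSup_nonneg ?_
    rintro _ ⟨p, -, rfl⟩
    exact hF0 _
  · have hbdd : BddAbove (Φ g '' ((K : Set G) ×ˢ (K : Set G))) :=
      (hKK.image (hΦ.comp (Continuous.prodMk_right g))).bddAbove
    have hle : F g ≤ sSup (Φ g '' ((K : Set G) ×ˢ (K : Set G))) :=
      le_csSup hbdd ⟨(1, 1), ⟨K.one_mem, K.one_mem⟩, by simp [Φ]⟩
    exact ((lt_of_le_of_ne (hF0 g) (Ne.symm hFg)).trans_le hle).ne'
  · intro k₁ hk₁ k₂ hk₂ x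
    dsimp only
    congr 1
    ext t
    constructor
    · rintro ⟨⟨a, b⟩, ⟨ha, hb⟩, rfl⟩
      exact ⟨(a * k₁, k₂ * b), ⟨K.mul_mem ha hk₁, K.mul_mem hk₂ hb⟩, by simp [Φ, mul_assoc]⟩
    · rintro ⟨⟨a, b⟩, ⟨ha, hb⟩, rfl⟩
      exact ⟨(a * k₁⁻¹, k₂⁻¹ * b),
        ⟨K.mul_mem ha (K.inv_mem hk₁), K.mul_mem (K.inv_mem hk₂) hb⟩, by simp [Φ, mul_assoc]⟩

/-- A continuous biinvariant vector-valued function is determined by its integrals against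
continuous compactly supported biinvariant functions. -/
theorem eq_zero_of_forall_integral_biinvariant_smul_eq_zero {G H : Type*} [Group G]
    [TopologicalSpace G] [IsTopologicalGroup G] [T2Space G] [LocallyCompactSpace G]
    [MeasurableSpace G] [BorelSpace G] [NormedAddCommGroup H] [InnerProductSpace ℂ H]
    [CompleteSpace H] {K : Subgroup G} (hK : IsCompact (K : Set G)) {D : G → H}
    (hD : Continuous D) (hDK : ∀ k₁ ∈ K, ∀ k₂ ∈ K, ∀ g, D (k₁ * g * k₂) = D g)
    (h : ∀ f : G → ℂ, Continuous f → HasCompactSupport f → IsBiinvariant K f →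
      ∫ x, f x • D x ∂(Measure.haar : Measure G) = 0) (g : G) : D g = 0 := by
  obtain ⟨χ, hχ, hχc, hχ0, hχg, hχK⟩ := exists_biinvariant_bump hK g
  by_contra hne
  let u : G → ℝ := fun x => χ x * ‖inner ℂ (D g) (D x)‖ ^ 2
  have hpos : 0 < ∫ x, u x ∂(Measure.haar : Measure G) := by
    refine Continuous.integral_pos_of_hasCompactSupport_nonneg_nonzero (x := g) (by fun_prop)
      hχc.mul_right (fun x => mul_nonneg (hχ0 x) (sq_nonneg _)) ?_
    exact mul_ne_zero hχg (by simpa using hne)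
  let f : G → ℂ := fun x => χ x * inner ℂ (D x) (D g)
  have hf : Continuous f := by fun_prop
  have hfc : HasCompactSupport f := (hχc.comp_left (g := ((↑) : ℝ → ℂ)) rfl).mul_right
  have hfK : IsBiinvariant K f := fun k₁ hk₁ k₂ hk₂ x => by
    simp only [f, hχK k₁ hk₁ k₂ hk₂, hDK k₁ hk₁ k₂ hk₂]
  have hint : Integrable (fun x => f x • D x) (Measure.haar : Measure G) :=
    (hf.smul hD).integrable_of_hasCompactSupport hfc.smul_right
  have h0 := integral_inner (𝕜 := ℂ) hint (D g)
  rw [h f hf hfc hfK, inner_zero_right] at h0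
  have hfu : (fun x => inner ℂ (D g) (f x • D x)) = fun x => ((u x : ℝ) : ℂ) := by
    funext x
    simp only [f, u, inner_smul_right]
    rw [mul_assoc, ← inner_conj_symm (D x) (D g), ← Complex.normSq_eq_conj_mul_self,
      Complex.normSq_eq_norm_sq]
    push_cast
    rfl
  rw [hfu, integral_complex_ofReal] at h0
  exact hpos.ne' (by exact_mod_cast h0)

/-! ### Integrated operators -/

namespace UnitaryRep

variable {G H : Type*} [Group G] [TopologicalSpace G] [NormedAddCommGroup H]
  [InnerProductSpace ℂ H] [CompleteSpace H] (π : UnitaryRep G H)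

theorem mul_apply (g h : G) (v : H) :
    π.toMonoidHom (g * h) v = π.toMonoidHom g (π.toMonoidHom h v) := by
  rw [map_mul]
  rfl

theorem norm_apply (g : G) (v : H) : ‖π.toMonoidHom g v‖ = ‖v‖ :=
  ((π.toMonoidHom g).norm_map_iff_adjoint_comp_self.mpr
    (Unitary.star_mul_self_of_mem (π.mem_unitary g))) v

theorem star_apply [IsTopologicalGroup G] (g : G) :
    star (π.toMonoidHom g) = π.toMonoidHom g⁻¹ := by
  have h1 := Unitary.star_mul_self_of_mem (π.mem_unitary g)
  refine left_inv_eq_right_inv h1 ?_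
  rw [← map_mul, mul_inv_cancel, map_one]

theorem inner_apply_left [IsTopologicalGroup G] (g : G) (v w : H) :
    inner ℂ (π.toMonoidHom g v) w = inner ℂ v (π.toMonoidHom g⁻¹ w) := by
  rw [← π.star_apply, ContinuousLinearMap.star_eq_adjoint,
    ContinuousLinearMap.adjoint_inner_right]

section Integrated

variable [IsTopologicalGroup G] [LocallyCompactSpace G] [MeasurableSpace G] [BorelSpace G]

theorem integrable_smul_apply {f : G → ℂ} (hf : Continuous f) (hfc : HasCompactSupport f)
    (v : H) :
    Integrable (fun x => f x • π.toMonoidHom x v) (Measure.haar : Measure G) :=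
  (hf.smul (π.continuous_apply v)).integrable_of_hasCompactSupport hfc.smul_right

/-- The integrated operator `π(f) v = ∫ f x • π(x) v dx` of a continuous compactly supported
function `f`, for left Haar measure. -/
noncomputable def integrated {f : G → ℂ} (hf : Continuous f) (hfc : HasCompactSupport f) :
    H →L[ℂ] H :=
  LinearMap.mkContinuous
    { toFun := fun v => ∫ x, f x • π.toMonoidHom x v ∂(Measure.haar : Measure G)
      map_add' := fun v w => by
        simp only [map_add, smul_add]
        exact integral_add (π.integrable_smul_apply hf hfc v) (π.integrable_smul_apply hf hfc w)
      map_smul' := fun c v => by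
        simp only [map_smul, RingHom.id_apply, smul_comm _ c]
        exact integral_smul _ _ }
    (∫ x, ‖f x‖ ∂(Measure.haar : Measure G)) fun v => by
      refine (norm_integral_le_integral_norm _).trans_eq ?_
      simp only [norm_smul, norm_apply]
      exact integral_mul_const _ _

theorem integrated_apply {f : G → ℂ} (hf : Continuous f) (hfc : HasCompactSupport f) (v : H) :
    π.integrated hf hfc v = ∫ x, f x • π.toMonoidHom x v ∂(Measure.haar : Measure G) := rfl

/-- A bounded operator can be moved inside the integral defining `π(f)`. -/
theorem map_integrated_apply {f : G → ℂ} (hf : Continuous f) (hfc : HasCompactSupport f)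
    (B : H →L[ℂ] H) (v : H) :
    B (π.integrated hf hfc v) =
      ∫ x, f x • B (π.toMonoidHom x v) ∂(Measure.haar : Measure G) := by
  rw [integrated_apply, ← B.integral_comp_comm (π.integrable_smul_apply hf hfc v)]
  simp only [map_smul]

/-- Integration turns convolution into composition. Compact supports make Fubini's theorem
available although Haar measure need not be `σ`-finite. -/
theorem integrated_apply_integrated {f h : G → ℂ} (hf : Continuous f)
    (hfc : HasCompactSupport f) (hh : Continuous h) (hhc : HasCompactSupport h) (v : H) :
    π.integrated hf hfc (π.integrated hh hhc v) =
      ∫ y, haarConvolution f h y • π.toMonoidHom y v ∂(Measure.haar : Measure G) := by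
  have hleft : ∀ x, π.toMonoidHom x (π.integrated hh hhc v) =
      ∫ y, h (x⁻¹ * y) • π.toMonoidHom y v ∂(Measure.haar : Measure G) := by
    intro x
    rw [map_integrated_apply, ← integral_mul_left_eq_self (μ := (Measure.haar : Measure G))
      (fun y => h (x⁻¹ * y) • π.toMonoidHom y v) x]
    simp only [inv_mul_cancel_left, mul_apply]
  rw [integrated_apply π hf hfc]
  simp only [hleft, ← integral_smul]
  rw [integral_integral_swap_of_hasCompactSupport]
  · refine integral_congr_ae (Filter.Eventually.of_forall fun y => ?_)
    simp only [haarConvolution, smul_smul]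
    exact integral_smul_const _ _
  · have := π.continuous_apply v
    simp only [Function.uncurry_def]
    fun_prop
  · refine HasCompactSupport.intro (hfc.isCompact.prod (hfc.isCompact.mul hhc.isCompact)) ?_
    rintro ⟨x, y⟩ hxy
    by_contra hne
    simp only [Function.uncurry_apply_pair, smul_eq_zero, not_or] at hne
    have hx := subset_tsupport f hne.1
    exact hxy ⟨hx, x, hx, x⁻¹ * y, subset_tsupport h hne.2.1, mul_inv_cancel_left x y⟩

end Integrated

/-! ### Invariant vectors -/

/-- The closed subspace of `K`-invariant vectors. -/
def invariants (K : Subgroup G) : Submodule ℂ H where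
  carrier := {v | ∀ k ∈ K, π.toMonoidHom k v = v}
  add_mem' hv hw k hk := by rw [map_add, hv k hk, hw k hk]
  zero_mem' k _ := map_zero _
  smul_mem' c v hv k hk := by rw [map_smul, hv k hk]

variable {π} {K : Subgroup G}

theorem mem_invariants {v : H} : v ∈ π.invariants K ↔ ∀ k ∈ K, π.toMonoidHom k v = v :=
  Iff.rfl

variable (π K) in
theorem isClosed_invariants : IsClosed (π.invariants K : Set H) := by
  have : (π.invariants K : Set H) = ⋂ k ∈ K, {v | π.toMonoidHom k v = v} := by
    ext v
    simp [mem_invariants]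
  rw [this]
  exact isClosed_biInter fun k _ => isClosed_eq (by fun_prop) continuous_id

instance : (π.invariants K).HasOrthogonalProjection :=
  have := (isClosed_invariants π K).completeSpace_coe
  inferInstance

variable (π K) in
/-- The orthogonal projection onto the `K`-invariant vectors. -/
noncomputable def invProj : H →L[ℂ] H := (π.invariants K).starProjection

theorem invProj_mem (v : H) : π.invProj K v ∈ π.invariants K :=
  Submodule.starProjection_apply_mem _ _

theorem invProj_eq_self {v : H} (hv : v ∈ π.invariants K) : π.invProj K v = v :=
  Submodule.starProjection_eq_self_iff.mpr hv

theorem star_invProj : star (π.invProj K) = π.invProj K :=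
  isSelfAdjoint_starProjection _

/-- `P π(k) = P` for `k ∈ K`, where `P` is the projection onto the invariant vectors. -/
theorem invProj_apply_of_mem [IsTopologicalGroup G] {k : G} (hk : k ∈ K) (v : H) :
    π.invProj K (π.toMonoidHom k v) = π.invProj K v := by
  refine ext_inner_right ℂ fun w => ?_
  unfold invProj
  rw [Submodule.inner_starProjection_left_eq_right, Submodule.inner_starProjection_left_eq_right,
    inner_apply_left, mem_invariants.1 (Submodule.starProjection_apply_mem _ _) _ (K.inv_mem hk)]

theorem star_mem_commutant [IsTopologicalGroup G] {S : H →L[ℂ] H} (hS : S ∈ π.commutant) :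
    star S ∈ π.commutant := by
  rw [commutant, Subalgebra.mem_centralizer_iff] at hS ⊢
  rintro _ ⟨g, rfl⟩
  have := congrArg star (hS _ ⟨g⁻¹, rfl⟩)
  simpa [star_mul, star_apply] using this.symm

theorem commutant_apply {S : H →L[ℂ] H} (hS : S ∈ π.commutant) (g : G) (v : H) :
    S (π.toMonoidHom g v) = π.toMonoidHom g (S v) :=
  (DFunLike.congr_fun ((Subalgebra.mem_centralizer_iff ℂ).1 hS _ ⟨g, rfl⟩) v).symm

theorem commutant_apply_mem_invariants {S : H →L[ℂ] H} (hS : S ∈ π.commutant) {v : H}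
    (hv : v ∈ π.invariants K) : S v ∈ π.invariants K := fun k hk => by
  rw [← commutant_apply hS, hv k hk]

/-- Both `S` and `star S` preserve the invariant vectors, so `S` commutes with the projection. -/
theorem commutant_apply_invProj [IsTopologicalGroup G] {S : H →L[ℂ] H} (hS : S ∈ π.commutant)
    (v : H) : S (π.invProj K v) = π.invProj K (S v) := by
  symm
  refine Submodule.eq_starProjection_of_mem_of_inner_eq_zero
    (commutant_apply_mem_invariants hS (invProj_mem v)) fun w hw => ?_
  rw [← map_sub, ← ContinuousLinearMap.adjoint_inner_right]
  exact Submodule.starProjection_inner_eq_zero _ _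
    (commutant_apply_mem_invariants (star_mem_commutant hS) hw)

/-! ### The compressed operators `P π(g) P` commute -/

theorem integrated_mem_invariants [IsTopologicalGroup G] [LocallyCompactSpace G]
    [MeasurableSpace G] [BorelSpace G] {f : G → ℂ} (hf : Continuous f)
    (hfc : HasCompactSupport f) (hfK : IsBiinvariant K f) (v : H) :
    π.integrated hf hfc v ∈ π.invariants K := fun k hk => by
  rw [map_integrated_apply, integrated_apply,
    ← integral_mul_left_eq_self (μ := (Measure.haar : Measure G))
      (fun x => f x • π.toMonoidHom x v) k]
  refine integral_congr_ae (Filter.Eventually.of_forall fun x => ?_)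
  have := hfK k hk 1 K.one_mem x
  rw [mul_one] at this
  simp only [this, mul_apply]

/-- If `w` and `w'` are invariant, then an identity `A (π(f) w) = B (π(f) w')` for all
biinvariant test functions `f` passes to `A (P π(g) w) = B (P π(g) w')`: the difference is a
continuous biinvariant function of `g`. -/
theorem map_invProj_eq_of_forall_integrated [IsTopologicalGroup G] [T2Space G]
    [LocallyCompactSpace G] [MeasurableSpace G] [BorelSpace G] (hK : IsCompact (K : Set G))
    {w w' : H} (hw : w ∈ π.invariants K) (hw' : w' ∈ π.invariants K) (A B : H →L[ℂ] H)
    (h : ∀ (f : G → ℂ) (hf : Continuous f) (hfc : HasCompactSupport f), IsBiinvariant K f →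
      A (π.integrated hf hfc w) = B (π.integrated hf hfc w')) (g : G) :
    A (π.invProj K (π.toMonoidHom g w)) = B (π.invProj K (π.toMonoidHom g w')) := by
  have hc := π.continuous_apply w
  have hc' := π.continuous_apply w'
  refine sub_eq_zero.1 (eq_zero_of_forall_integral_biinvariant_smul_eq_zero hK
    (D := fun g => A (π.invProj K (π.toMonoidHom g w)) - B (π.invProj K (π.toMonoidHom g w')))
    (by fun_prop) (fun k₁ hk₁ k₂ hk₂ g => ?_) (fun f hf hfc hfK => ?_) g)
  · simp only [mul_apply, hw k₂ hk₂, hw' k₂ hk₂, invProj_apply_of_mem hk₁]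
  · have key : ∀ (C : H →L[ℂ] H) (v : H),
        Integrable (fun x => f x • C (π.toMonoidHom x v)) (Measure.haar : Measure G) :=
      fun C v => by
        have := C.integrable_comp (π.integrable_smul_apply hf hfc v)
        simpa only [map_smul] using this
    simp only [smul_sub]
    refine (integral_sub (key (A ∘L π.invProj K) w) (key (B ∘L π.invProj K) w')).trans ?_
    rw [← map_integrated_apply π hf hfc, ← map_integrated_apply π hf hfc]
    simp only [ContinuousLinearMap.comp_apply,
      invProj_eq_self (integrated_mem_invariants hf hfc hfK _), h f hf hfc hfK, sub_self]

variable (π K) in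
/-- The compression `P π(g) P` of `π(g)` to the invariant vectors. -/
noncomputable def compression (g : G) : H →L[ℂ] H :=
  π.invProj K * π.toMonoidHom g * π.invProj K

theorem compression_apply (g : G) (v : H) :
    π.compression K g v = π.invProj K (π.toMonoidHom g (π.invProj K v)) := rfl

theorem star_compression [IsTopologicalGroup G] (g : G) :
    star (π.compression K g) = π.compression K g⁻¹ := by
  simp only [compression, star_mul, star_invProj, star_apply, mul_assoc]

theorem compression_apply_of_mem {v : H} (hv : v ∈ π.invariants K) (g : G) :
    π.compression K g v = π.invProj K (π.toMonoidHom g v) := by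
  rw [compression_apply, invProj_eq_self hv]

theorem compression_comm [IsTopologicalGroup G] [T2Space G] [LocallyCompactSpace G]
    [MeasurableSpace G] [BorelSpace G] (hGK : IsGelfandPair K) (g h : G) :
    π.compression K g * π.compression K h = π.compression K h * π.compression K g := by
  ext v
  let w := π.invProj K v
  have hw : w ∈ π.invariants K := invProj_mem v
  have hww : π.invProj K w = w := invProj_eq_self hw
  have h1 : ∀ (f₁ f₂ : G → ℂ) (hf₁ : Continuous f₁) (hfc₁ : HasCompactSupport f₁)
      (hf₂ : Continuous f₂) (hfc₂ : HasCompactSupport f₂), IsBiinvariant K f₁ →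
      IsBiinvariant K f₂ → π.integrated hf₁ hfc₁ (π.integrated hf₂ hfc₂ w) =
        π.integrated hf₂ hfc₂ (π.integrated hf₁ hfc₁ w) := by
    intro f₁ f₂ hf₁ hfc₁ hf₂ hfc₂ hK₁ hK₂
    rw [integrated_apply_integrated, integrated_apply_integrated]
    refine integral_congr_ae ?_
    filter_upwards [hGK.convolution_comm f₁ f₂ (hf₁.integrable_of_hasCompactSupport hfc₁)
      (hf₂.integrable_of_hasCompactSupport hfc₂) hK₁ hK₂] with y hy
    rw [hy]
  -- The two test functions are replaced by group elements one after the other.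
  have h2 : ∀ (f : G → ℂ) (hf : Continuous f) (hfc : HasCompactSupport f), IsBiinvariant K f →
      π.compression K g (π.integrated hf hfc w) =
        π.integrated hf hfc (π.compression K g w) := by
    intro f hf hfc hfK
    have hm := integrated_mem_invariants hf hfc hfK w (π := π)
    rw [compression_apply_of_mem hm, compression_apply_of_mem hw]
    exact map_invProj_eq_of_forall_integrated hGK.isCompact hm hw (ContinuousLinearMap.id ℂ H)
      (π.integrated hf hfc) (fun f₁ hf₁ hfc₁ hK₁ => h1 f₁ f hf₁ hfc₁ hf hfc hK₁ hfK) g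
  have hm : π.compression K g w ∈ π.invariants K := invProj_mem _
  have h3 := map_invProj_eq_of_forall_integrated hGK.isCompact hw hm (π.compression K g)
    (ContinuousLinearMap.id ℂ H) h2 h
  rw [← compression_apply_of_mem hw, ContinuousLinearMap.id_apply,
    ← compression_apply_of_mem hm] at h3
  have hv : ∀ x, π.compression K x v = π.compression K x w := fun x => by
    rw [compression_apply, compression_apply, hww]
  simpa only [mul_apply_eq_comp, hv] using h3

end UnitaryRep

/-! ### Commutants of commutative self-adjoint families -/

/-- Let `A` be a self-adjoint space of pairwise commuting operators, and let `S`, `T` commute with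
`A` and satisfy `S ξ, T ξ ∈ closure (A ξ)`. Then `S T ξ` and `T S ξ` have the same inner products
with `A ξ`. Indeed, if `aₙ ξ → S ξ` and `bₙ ξ → T ξ`, then `aₙ bₙ ξ` tends weakly against `A ξ`
to `T S ξ`; the roles of `S` and `T` being symmetric, it also tends to `S T ξ`. -/
theorem inner_apply_comm_of_commutative {H : Type*} [NormedAddCommGroup H]
    [InnerProductSpace ℂ H] [CompleteSpace H] {A : Set (H →L[ℂ] H)}
    (hstar : ∀ a ∈ A, star a ∈ A) (hcomm : ∀ a ∈ A, ∀ b ∈ A, a * b = b * a) {S T : H →L[ℂ] H}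
    (hS : ∀ a ∈ A, S * a = a * S) (hT : ∀ a ∈ A, T * a = a * T) {ξ : H}
    (hSξ : S ξ ∈ closure ((fun a : H →L[ℂ] H => a ξ) '' A))
    (hTξ : T ξ ∈ closure ((fun a : H →L[ℂ] H => a ξ) '' A)) {c : H →L[ℂ] H} (hc : c ∈ A) :
    inner ℂ (c ξ) (S (T ξ)) = inner ℂ (c ξ) (T (S ξ)) := by
  have app : ∀ {x y : H →L[ℂ] H}, x * y = y * x → ∀ v, x (y v) = y (x v) :=
    fun h v => DFunLike.congr_fun h v
  have main : ∀ (T S : H →L[ℂ] H), (∀ a ∈ A, T * a = a * T) → ∀ a b : ℕ → H →L[ℂ] H,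
      (∀ n, a n ∈ A) → (∀ n, b n ∈ A) →
      Filter.Tendsto (fun n => a n ξ) Filter.atTop (nhds (S ξ)) →
      Filter.Tendsto (fun n => b n ξ) Filter.atTop (nhds (T ξ)) →
      Filter.Tendsto (fun n => inner ℂ (c ξ) (a n (b n ξ))) Filter.atTop
        (nhds (inner ℂ (c ξ) (T (S ξ)))) := by
    intro T S hT a b ha hb hla hlb
    have hid : ∀ n, inner ℂ (c ξ) (a n (b n ξ)) = inner ℂ (c ξ) (T (a n ξ)) +
        inner ℂ (c (star (a n) ξ)) (b n ξ - T ξ) := by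
      intro n
      rw [← app (hcomm _ (hstar _ (ha n)) _ hc), ContinuousLinearMap.star_eq_adjoint,
        ContinuousLinearMap.adjoint_inner_left, map_sub, inner_sub_right, app (hT _ (ha n))]
      ring
    -- Elements of `A` are normal, so `‖aₙ* ξ‖ = ‖aₙ ξ‖` stays bounded.
    have hnorm : ∀ n, ‖star (a n) ξ‖ = ‖a n ξ‖ := fun n => by
      have hn : IsStarNormal (a n) := ⟨hcomm _ (hstar _ (ha n)) _ (ha n)⟩
      exact (ContinuousLinearMap.isStarNormal_iff_norm_eq_adjoint.1 hn ξ).symm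
    have h1 : Filter.Tendsto (fun n => inner ℂ (c ξ) (T (a n ξ))) Filter.atTop
        (nhds (inner ℂ (c ξ) (T (S ξ)))) :=
      tendsto_const_nhds.inner ((T.continuous.tendsto _).comp hla)
    have h2 : Filter.Tendsto (fun n => inner ℂ (c (star (a n) ξ)) (b n ξ - T ξ)) Filter.atTop
        (nhds 0) := by
      have hlim : Filter.Tendsto (fun n => ‖c‖ * ‖a n ξ‖ * ‖b n ξ - T ξ‖) Filter.atTop
          (nhds 0) := by
        have := ((hla.norm.const_mul ‖c‖).mul (hlb.sub_const (T ξ)).norm)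
        simpa using this
      refine squeeze_zero_norm (fun n => ?_) hlim
      refine (norm_inner_le_norm _ _).trans ?_
      gcongr
      rw [← hnorm]
      exact c.le_opNorm _
    simpa only [hid, add_zero] using h1.add h2
  obtain ⟨x, hx, hlx⟩ := mem_closure_iff_seq_limit.1 hSξ
  obtain ⟨y, hy, hly⟩ := mem_closure_iff_seq_limit.1 hTξ
  choose a ha hax using hx
  choose b hb hby using hy
  replace hlx := hlx.congr fun n => (hax n).symm
  replace hly := hly.congr fun n => (hby n).symm
  have h1 := main T S hT a b ha hb hlx hly
  have h2 := main S T hS b a hb ha hly hlx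
  refine tendsto_nhds_unique h2 (h1.congr fun n => ?_)
  rw [app (hcomm _ (ha n) _ (hb n))]

/-! ### Commutativity of the commutant -/

namespace UnitaryRep

variable {G H : Type*} [Group G] [TopologicalSpace G] [NormedAddCommGroup H]
  [InnerProductSpace ℂ H] [CompleteSpace H] {π : UnitaryRep G H} {K : Subgroup G}

variable (π K) in
/-- The linear span of the compressions `P π(g) P`. -/
def compressionSpan : Submodule ℂ (H →L[ℂ] H) :=
  Submodule.span ℂ (Set.range (π.compression K))

theorem star_mem_compressionSpan [IsTopologicalGroup G] {a : H →L[ℂ] H}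
    (ha : a ∈ π.compressionSpan K) : star a ∈ π.compressionSpan K := by
  induction ha using Submodule.span_induction with
  | mem x hx =>
    obtain ⟨g, rfl⟩ := hx
    rw [star_compression]
    exact Submodule.subset_span ⟨_, rfl⟩
  | zero => simp
  | add x y _ _ hx hy => rw [star_add]; exact add_mem hx hy
  | smul c x _ hx => rw [star_smul]; exact Submodule.smul_mem _ _ hx

/-- An operator commuting with all compressions commutes with their span. -/
theorem mul_comm_of_mem_compressionSpan {S a : H →L[ℂ] H}
    (hS : ∀ g, S * π.compression K g = π.compression K g * S) (ha : a ∈ π.compressionSpan K) :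
    S * a = a * S := by
  induction ha using Submodule.span_induction with
  | mem x hx => obtain ⟨g, rfl⟩ := hx; exact hS g
  | zero => simp
  | add x y _ _ hx hy => rw [mul_add, add_mul, hx, hy]
  | smul c x _ hx => rw [mul_smul_comm, smul_mul_assoc, hx]

/-- If `ξ` is invariant and cyclic, it is cyclic for the compressions acting on the invariant
vectors. -/
theorem mem_closure_compressionSpan_apply {ξ : H} (hξ : ξ ∈ π.invariants K)
    (hcyc : (Submodule.span ℂ (Set.range fun g => π.toMonoidHom g ξ)).topologicalClosure = ⊤)
    {v : H} (hv : v ∈ π.invariants K) :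
    v ∈ closure ((fun a : H →L[ℂ] H => a ξ) '' (π.compressionSpan K : Set (H →L[ℂ] H))) := by
  rw [← invProj_eq_self hv]
  have hmaps : Set.MapsTo (π.invProj K)
      (Submodule.span ℂ (Set.range fun g => π.toMonoidHom g ξ) : Set H)
      ((fun a : H →L[ℂ] H => a ξ) '' (π.compressionSpan K : Set (H →L[ℂ] H))) := by
    intro u hu
    induction hu using Submodule.span_induction with
    | mem x hx =>
      obtain ⟨g, rfl⟩ := hx
      exact ⟨π.compression K g, Submodule.subset_span ⟨g, rfl⟩, compression_apply_of_mem hξ g⟩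
    | zero => exact ⟨0, zero_mem _, by simp⟩
    | add x y _ _ hx hy =>
      obtain ⟨a, ha, hax⟩ := hx
      obtain ⟨b, hb, hby⟩ := hy
      exact ⟨a + b, add_mem ha hb, by rw [map_add, ← hax, ← hby]; rfl⟩
    | smul c x _ hx =>
      obtain ⟨a, ha, hax⟩ := hx
      exact ⟨c • a, Submodule.smul_mem _ _ ha, by rw [map_smul, ← hax]; rfl⟩
  refine hmaps.closure (π.invProj K).continuous ?_
  rw [← Submodule.topologicalClosure_coe, hcyc]
  trivial

/-- A cyclic vector is separating for the commutant. -/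
theorem commutant_eq_of_apply_eq {S T : H →L[ℂ] H} (hS : S ∈ π.commutant) (hT : T ∈ π.commutant)
    {ξ : H}
    (hcyc : (Submodule.span ℂ (Set.range fun g => π.toMonoidHom g ξ)).topologicalClosure = ⊤)
    (h : S ξ = T ξ) : S = T := by
  refine ContinuousLinearMap.ext_on (Submodule.dense_iff_topologicalClosure_eq_top.2 hcyc) ?_
  rintro _ ⟨g, rfl⟩
  dsimp only
  rw [commutant_apply hS, commutant_apply hT, h]

/-- For a Gelfand pair, a representation with a cyclic invariant vector has commutative
commutant. -/
theorem commutant_comm [IsTopologicalGroup G] [T2Space G] [LocallyCompactSpace G]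
    [MeasurableSpace G] [BorelSpace G] (hGK : IsGelfandPair K) {ξ : H}
    (hξ : ξ ∈ π.invariants K)
    (hcyc : (Submodule.span ℂ (Set.range fun g => π.toMonoidHom g ξ)).topologicalClosure = ⊤)
    {S T : H →L[ℂ] H} (hS : S ∈ π.commutant) (hT : T ∈ π.commutant) : S * T = T * S := by
  refine commutant_eq_of_apply_eq (mul_mem hS hT) (mul_mem hT hS) hcyc ?_
  have hcompr : ∀ {R : H →L[ℂ] H}, R ∈ π.commutant →
      ∀ a ∈ π.compressionSpan K, R * a = a * R := fun hR a ha => by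
    refine mul_comm_of_mem_compressionSpan (fun g => ?_) ha
    ext v
    simp only [mul_apply_eq_comp, compression_apply, commutant_apply_invProj hR,
      commutant_apply hR]
  have hmem : ∀ {R : H →L[ℂ] H}, R ∈ π.commutant → R ξ ∈ π.invariants K := fun hR =>
    commutant_apply_mem_invariants hR hξ
  have hcl := fun {v : H} => mem_closure_compressionSpan_apply (v := v) hξ hcyc
  have hin : ∀ c ∈ π.compressionSpan K,
      inner ℂ (c ξ) (S (T ξ) - T (S ξ)) = 0 := fun c hc => by
    rw [inner_sub_right, sub_eq_zero]
    exact inner_apply_comm_of_commutative (A := π.compressionSpan K)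
      (fun a ha => star_mem_compressionSpan ha)
      (fun a ha b hb => mul_comm_of_mem_compressionSpan (fun g =>
        (mul_comm_of_mem_compressionSpan (fun h => compression_comm hGK g h) ha).symm) hb)
      (hcompr hS) (hcompr hT) (hcl (hmem hS)) (hcl (hmem hT)) hc
  -- `S T ξ - T S ξ` is invariant, hence a limit of vectors `c ξ` orthogonal to it.
  have hd : S (T ξ) - T (S ξ) ∈ π.invariants K :=
    sub_mem (commutant_apply_mem_invariants hS (hmem hT))
      (commutant_apply_mem_invariants hT (hmem hS))
  have hclosed : IsClosed {u : H | inner ℂ u (S (T ξ) - T (S ξ)) = 0} :=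
    isClosed_eq (by fun_prop) continuous_const
  have h0 := closure_minimal (by rintro _ ⟨c, hc, rfl⟩; exact hin c hc) hclosed (hcl hd)
  exact sub_eq_zero.1 (inner_self_eq_zero.1 h0)

end UnitaryRep

theorem theorem3 {G : Type*} [Group G] [TopologicalSpace G] [IsTopologicalGroup G] [T2Space G]
    [LocallyCompactSpace G] [MeasurableSpace G] [BorelSpace G]
    (K : Subgroup G) (hGK : IsGelfandPair K)
    (φ : G → ℂ) (hc : Continuous φ) (hK : IsBiinvariant K φ) (hφ : IsPositiveType φ) :
    (∀ S ∈ (gnsRep hφ hc).commutant, ∀ T ∈ (gnsRep hφ hc).commutant, S * T = T * S) ∧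
    (∀ (H : Type*) [NormedAddCommGroup H] [InnerProductSpace ℂ H] [CompleteSpace H]
      (π : UnitaryRep G H) (ξ : H), IsGNSTriple K φ π ξ →
        ∀ S ∈ π.commutant, ∀ T ∈ π.commutant, S * T = T * S) := by
  have htriple := isGNSTriple_gnsRep hφ hc hK
  exact ⟨fun _ hS _ hT => UnitaryRep.commutant_comm hGK htriple.invariant htriple.cyclic hS hT,
    fun _ _ _ _ _ _ h _ hS _ hT => UnitaryRep.commutant_comm hGK h.invariant h.cyclic hS hT⟩
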